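/- Let $\bar\Phi(t)=\Pr[g\ge t]$ for $g\sim\mathcal N(0,1)$, and let $\mathbf r$ be a standard Gaussian vector in $\mathbb R^d$ ($d$ arbitrary). Let $X\subseteq\mathbb R^d$ be a set of unit vectors and $\mu$ a measure on $X$. - $(X,\mu)$ is an *$(s,\delta)$-packing* if $\mu(X')\le\Pr[\exists\,\mathbf x\in X':\mathbf r\cdot\mathbf x\ge s]$ for every $X'\subseteq X$, and $\mu(X)\ge\delta$. - $X$ is *$c$-inefficient* (with respect to $s$) if $|X|\le\bar\Phi(s)^{-(1+c)}$. - For a set $V$ of unit vectors, $(X,\mu)$ is *$(\lambda,p,V)$-spread* if $\mu(\{\mathbf x\in X:\mathbf v\cdot\mathbf x\ge\lambda\})\le p$ for every $\mathbf v\in V$. **Lemma.** For every $c>0$ there are constants $c'>0$ and $s_0$, depending only on $c$ (in particular not on $d$), such that the following two statements hold. (0) For all $s\ge s_0$, every $(s,\delta)$-packing $(X,\mu)$ with $X$ $c$-inefficient with respect to $s$, every set $V$ of unit vectors and every $\epsilon\ge\frac{\log s}{s}$, $(X,\mu)$ is $\left(\sqrt{\tfrac{c}{1+c}(1+\epsilon)},\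 \exp(-c'\epsilon^2s^2),\ V\right)$-spread. (1) Let $s_2\ge s_0$, let $(X_1,\mu_1)$ be an $(s_1,\delta_1)$-packing and $(X_2,\mu_2)$ an $(s_2,\delta_2)$-packing in the same space $\mathbb R^d$, where $X_2$ is $c$-inefficient with respect to $s_2$, and suppose that $(X_1,\mu_1)$ is $(\lambda,p,X_1)$-spread for some $\lambda,p>0$. Then for every integer $\sigma\ge1$, every $\epsilon\ge\frac{\log s_2}{s_2}$ and every $\alpha>\frac e4\left(\exp(-c'\epsilon^2s_2^2)\right)^{1/\sigma}$ there is a subset $X_1'\subseteq X_1$ such that - $\mu_1(X_1\setminus X_1')\le p\sigma/\alpha$, and $(X_1',\mu_1)$ is an $(s_1,\ \delta_1-p\sigma/\alpha)$-packing; - $(X_2,\mu_2)$ is $(\lambda',2\alpha,X_1')$-spread, where $\lambda'=\sqrt{\lambda\cdot\frac{c}{1+c}(1+\epsilon)\left(1+\frac1{\lambda\sigma}\right)}$. -/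

import Mathlib

open MeasureTheory ProbabilityTheory

noncomputable section

/-- The standard Gaussian tail probability `1 - Φ(t)`. -/
def gaussianTail (t : ℝ) : ℝ := 1 - cdf (gaussianReal 0 1) t

/-- A set of unit vectors. -/
def IsUnitSet {d : ℕ} (X : Set (EuclideanSpace ℝ (Fin d))) : Prop :=
  ∀ x ∈ X, ‖x‖ = 1

/-- The probability that some `x ∈ X` satisfies `r · x ≥ s`, where `r` is a standard Gaussian
vector. -/
def coverProb {d : ℕ} (s : ℝ) (X : Set (EuclideanSpace ℝ (Fin d))) : ENNReal :=
  stdGaussian (EuclideanSpace ℝ (Fin d)) {r | ∃ x ∈ X, s ≤ inner ℝ r x}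

/-- `(X, μ)` is an `(s, δ)`-packing. Only the values of `μ` on subsets of `X` matter. -/
def IsPacking {d : ℕ} (s δ : ℝ) (X : Set (EuclideanSpace ℝ (Fin d)))
    (μ : Measure (EuclideanSpace ℝ (Fin d))) : Prop :=
  IsUnitSet X ∧ (∀ X' ⊆ X, μ X' ≤ coverProb s X') ∧ ENNReal.ofReal δ ≤ μ X

/-- `X` is (at most) `c`-inefficient with respect to `s`. -/
def IsInefficient {d : ℕ} (c s : ℝ) (X : Set (EuclideanSpace ℝ (Fin d))) : Prop :=
  X.Finite ∧ (X.ncard : ℝ) ≤ gaussianTail s ^ (-(1 + c))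

/-- `(X, μ)` is `(lam, p, V)`-spread. -/
def IsSpread {d : ℕ} (lam p : ℝ) (V X : Set (EuclideanSpace ℝ (Fin d)))
    (μ : Measure (EuclideanSpace ℝ (Fin d))) : Prop :=
  ∀ v ∈ V, μ {x ∈ X | lam ≤ inner ℝ v x} ≤ ENNReal.ofReal p

/-- `c'` is a spread constant for `c`: for all sufficiently large `s` and every `ε ≥ log s / s`,
every `c`-inefficient `(s, δ)`-packing, in any dimension, is
`(√(c / (1 + c) * (1 + ε)), exp (-c' ε² s²), V)`-spread for every set `V` of unit vectors. -/
def IsSpreadConstant (c c' : ℝ) : Prop :=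
  0 < c' ∧ ∃ s₀ : ℝ, ∀ s ≥ s₀, ∀ (d : ℕ) (V X : Set (EuclideanSpace ℝ (Fin d)))
    (μ : Measure (EuclideanSpace ℝ (Fin d))) (δ : ℝ),
    IsUnitSet V → IsPacking s δ X μ → IsInefficient c s X →
    ∀ ε ≥ Real.log s / s,
      IsSpread (√(c / (1 + c) * (1 + ε))) (Real.exp (-c' * ε ^ 2 * s ^ 2)) V X μ

end

/-!
# Spread of inefficient Gaussian packings

**Inefficient packings are spread.** Let `A` be the part of a packing `X` having inner product at
least `√(c / (1 + c) * (1 + ε))` with a unit vector `v`. The packing property bounds `μ A` by the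
probability that a Gaussian vector `r` satisfies `r ⬝ x ≥ s` for some `x ∈ A`. Either `r ⬝ v ≥ τ s`
with `τ` of order `ε`, which has probability at most `exp (-τ² s² / 2)`, or `r ⬝ x ≥ s` happens
although `r ⬝ v ≤ τ s`. For one `x ∈ A` the latter has probability at most
`exp (-(1 + c + c ε / 2) s² / 2)` (`stdGaussian_joint_tail_le`), since the point of least norm in the
corresponding intersection of half-spaces is far from the origin. This beats the union bound over
the at most `Φ̄(s) ^ (-(1 + c))` points of `X` (`coverProb_cap_le`). The
`exp (O(s))` loss of a crude lower bound for `Φ̄(s)` is absorbed by `ε s² ≥ s log s`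
(`exp_add_exp_le`).

**Refining a packing.** Let `B` be the set of points `x ∈ X₁` for which the neighbourhood
`{y ∈ X₂ | x ⬝ y ≥ λ'}` has `μ₂`-measure at least `2 α`. If `x₁, …, x_σ ∈ X₁` have pairwise inner
products at most `λ`, then `‖∑ xᵢ‖² ≤ σ² λ + σ`, so a common neighbour `y` of all of them has inner
product at least `√(c / (1 + c) * (1 + ε))` with the direction of `∑ xᵢ`
(`exists_unit_of_nearly_orthogonal`). By the first part the common neighbours have measure at most
`q = exp (-c' ε² s₂²)`.

On the other hand, a random sequence in `B` has many common neighbours. Write `M = μ₁ B` and let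
`f y` be the measure of the neighbours of `y` in `B`, so that `∫ f dμ₂ ≥ 2 α M`. As `X₁` is
`(λ, p)`-spread, at most `j p` of `B` is excluded once `j` points are chosen, and choosing the points
greedily (`exists_greedy_sequence`) gives a sequence whose common neighbours have measure at least
`M ^ (-σ) ∫ ∏_{j < σ} (f - j p)₊ dμ₂`. The integrand is a convex function of `f`, so by Jensen's
inequality this is at least `∏_{j < σ} (2 α - j p / M)₊`. If `M > p σ / α` this exceeds
`α ^ σ ∏_{j < σ} (2 - j / σ) ≥ (4 α / e) ^ σ > q`, a contradiction (`measureReal_heavy_le`). Hence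
`X₁ \ B` is the required refinement.
-/

/-! ### Gaussian tail estimates -/

lemma mgf_inner_stdGaussian {d : ℕ} (q : EuclideanSpace ℝ (Fin d)) (t : ℝ) :
    mgf (fun r ↦ inner ℝ q r) (stdGaussian (EuclideanSpace ℝ (Fin d))) t =
      Real.exp (‖q‖ ^ 2 * t ^ 2 / 2) := by
  have h := IsGaussian.map_eq_gaussianReal (μ := stdGaussian (EuclideanSpace ℝ (Fin d)))
    (innerSL ℝ q)
  rw [integral_strongDual_stdGaussian, variance_dual_stdGaussian, innerSL_apply_norm] at h
  have h' := mgf_gaussianReal h t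
  rw [Real.coe_toNNReal _ (sq_nonneg _), zero_mul, zero_add] at h'
  exact h'

/-- The Chernoff bound for a linear functional of a standard Gaussian vector. The optimal exponent
is absorbed into the choice of `q`. -/
lemma stdGaussian_inner_ge_le {d : ℕ} (q : EuclideanSpace ℝ (Fin d)) (m : ℝ) :
    (stdGaussian (EuclideanSpace ℝ (Fin d))).real {r | m ≤ inner ℝ q r} ≤
      Real.exp (‖q‖ ^ 2 / 2 - m) := by
  have hint : Integrable (fun r ↦ Real.exp (1 * inner ℝ q r))
      (stdGaussian (EuclideanSpace ℝ (Fin d))) := by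
    by_contra hcon
    -- A non-integrable exponential would have moment generating function zero.
    exact (Real.exp_pos _).ne' ((mgf_inner_stdGaussian q 1).symm.trans (mgf_undef hcon))
  refine (measure_ge_le_exp_mul_mgf m zero_le_one hint).trans_eq ?_
  rw [mgf_inner_stdGaussian, ← Real.exp_add]
  ring_nf

/-- A crude lower bound for the Gaussian tail, from the density on `(s, s + 1]`. -/
lemma exp_le_gaussianTail {s : ℝ} (hs : 0 ≤ s) :
    Real.exp (-(s ^ 2 / 2 + s + 2)) ≤ gaussianTail s := by
  have h1 : gaussianTail s = (gaussianReal 0 1).real (Set.Ioi s) := by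
    rw [gaussianTail, cdf_eq_real, ← Set.compl_Iic, probReal_compl_eq_one_sub measurableSet_Iic]
  have h2 : (gaussianReal 0 1).real (Set.Ioc s (s + 1)) =
      ∫ x in Set.Ioc s (s + 1), gaussianPDFReal 0 1 x := by
    rw [measureReal_def, gaussianReal_apply_eq_integral 0 one_ne_zero, ENNReal.toReal_ofReal]
    exact integral_nonneg fun x ↦ gaussianPDFReal_nonneg _ _ _
  have hsqrt : √(2 * Real.pi) ≤ Real.exp (3 / 2) := by
    refine Real.sqrt_le_iff.2 ⟨(Real.exp_pos _).le, ?_⟩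
    rw [← Real.exp_nat_mul]
    have h3 := Real.add_one_le_exp (1 : ℝ)
    have h4 : Real.exp ((2 : ℕ) * (3 / 2)) = Real.exp 1 ^ 3 := by
      rw [← Real.exp_nat_mul]; norm_num
    rw [h4]
    nlinarith [Real.pi_le_four, pow_le_pow_left₀ (by norm_num) h3 3]
  have h5 : Real.exp (-(s ^ 2 / 2 + s + 2)) * volume.real (Set.Ioc s (s + 1)) ≤
      ∫ x in Set.Ioc s (s + 1), gaussianPDFReal 0 1 x := by
    refine setIntegral_ge_of_const_le_real measurableSet_Ioc (by simp) (fun x hx ↦ ?_)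
      (integrable_gaussianPDFReal 0 1).integrableOn
    have hx2 : x ^ 2 ≤ (s + 1) ^ 2 := by
      have := hx.1; have := hx.2; nlinarith
    have h6 : Real.exp (-(3 / 2)) ≤ (√(2 * Real.pi))⁻¹ := by
      rw [Real.exp_neg]
      exact inv_anti₀ (by positivity) hsqrt
    have h7 : Real.exp (-(s + 1) ^ 2 / 2) ≤ Real.exp (-(x - 0) ^ 2 / (2 * 1)) :=
      Real.exp_le_exp.2 (by linarith)
    have h8 := mul_le_mul h6 h7 (Real.exp_pos _).le (by positivity)
    rw [← Real.exp_add] at h8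
    simp only [gaussianPDFReal, NNReal.coe_one, mul_one]
    refine le_trans (Real.exp_le_exp.2 (by nlinarith)) (h8.trans_eq (by norm_num))
  rw [measureReal_def, Real.volume_Ioc, add_sub_cancel_left, ENNReal.toReal_ofReal zero_le_one,
    mul_one] at h5
  rw [h1]
  exact (h5.trans_eq h2.symm).trans (measureReal_mono Set.Ioc_subset_Ioi_self)

lemma gaussianTail_rpow_le {c s : ℝ} (hc : 0 < c) (hs : 0 ≤ s) :
    gaussianTail s ^ (-(1 + c)) ≤ Real.exp ((1 + c) * (s ^ 2 / 2 + s + 2)) := by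
  refine (Real.rpow_le_rpow_of_nonpos (Real.exp_pos _) (exp_le_gaussianTail hs)
    (by linarith)).trans_eq ?_
  rw [← Real.exp_mul]
  ring_nf

/-! ### Inefficient packings are spread -/

/-- The joint tail of `r ⬝ x ≥ s` and `r ⬝ v ≤ τ s`: when `x` has correlation `a` with `v`,
where `(1 + c) a² ≥ c + u`, forbidding a noticeable component along `v` makes `r ⬝ x ≥ s` rarer by
a power. -/
lemma stdGaussian_joint_tail_le {d : ℕ} {c u s : ℝ} (hc : 0 < c) (hu : 0 ≤ u)
    (x v : EuclideanSpace ℝ (Fin d)) (hx : ‖x‖ = 1) (hv : ‖v‖ = 1) (ha : 0 ≤ inner ℝ v x)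
    (hau : c + u ≤ (1 + c) * inner ℝ v x ^ 2) (hs : 0 ≤ s) :
    (stdGaussian (EuclideanSpace ℝ (Fin d))).real
      {r | s ≤ inner ℝ r x ∧ inner ℝ v r ≤ u / (4 * (1 + c)) * s} ≤
      Real.exp (-(s ^ 2 / 2 * (1 + c + u / 2))) := by
  set a : ℝ := inner ℝ v x with hadef
  have ha1 : a ≤ 1 := by
    have := real_inner_le_norm v x
    rwa [hx, hv, mul_one] at this
  set β : ℝ := (1 + c) * a * s with hβ
  have hβ0 : 0 ≤ β := by positivity
  -- When `(1 + c) a² = c` and `u = 0`, this `q` is the point of least norm with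
  -- `⟪q, x⟫ ≥ s` and `⟪q, v⟫ ≤ 0`; the same multipliers suffice in general.
  set q := (s + β * a) • x - β • v with hq
  have hqn : ‖q‖ ^ 2 = s ^ 2 + β ^ 2 * (1 - a ^ 2) := by
    rw [hq, norm_sub_sq_real, norm_smul, norm_smul, hx, hv, real_inner_smul_left,
      real_inner_smul_right, real_inner_comm, ← hadef]
    simp only [mul_one, Real.norm_eq_abs, sq_abs]
    ring
  have hsub : {r | s ≤ inner ℝ r x ∧ inner ℝ v r ≤ u / (4 * (1 + c)) * s} ⊆
      {r | (s + β * a) * s - β * (u / (4 * (1 + c)) * s) ≤ inner ℝ q r} := by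
    rintro r ⟨h1, h2⟩
    rw [real_inner_comm] at h1
    simp only [Set.mem_ofPred_eq, hq, inner_sub_left, real_inner_smul_left]
    gcongr
  refine (measureReal_mono hsub).trans ((stdGaussian_inner_ge_le q _).trans ?_)
  rw [Real.exp_le_exp, hqn]
  have key : 1 + c + u / 2 ≤
      1 + 2 * ((1 + c) * a ^ 2) - a * u / 2 - (1 + c) ^ 2 * a ^ 2 * (1 - a ^ 2) := by
    have h1 : 0 ≤ ((1 + c) * a ^ 2 - (c + u)) * (1 + (1 + c) * a ^ 2 + u) :=
      mul_nonneg (by linarith) (by positivity)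
    nlinarith [mul_nonneg hu (sub_nonneg.2 ha1), mul_nonneg hc.le hu]
  have h2 := mul_le_mul_of_nonneg_left key (show 0 ≤ s ^ 2 / 2 by positivity)
  have h3 : β * (u / (4 * (1 + c)) * s) = s ^ 2 / 2 * (a * u / 2) := by
    rw [hβ]; field_simp; ring
  rw [h3]
  refine le_trans (le_of_eq ?_) (neg_le_neg h2)
  rw [hβ]
  ring

/-- The quantitative heart of the spread estimate: a Gaussian vector either has a large component
along `v`, or it meets one of at most `Φ̄(s) ^ (-(1 + c))` rare events. -/
lemma coverProb_cap_le {d : ℕ} {c s ε : ℝ} (hc : 0 < c) (hs : 0 ≤ s) (hε : 0 ≤ ε)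
    {X : Set (EuclideanSpace ℝ (Fin d))} (hX : IsUnitSet X) (hXc : IsInefficient c s X)
    (v : EuclideanSpace ℝ (Fin d)) (hv : ‖v‖ = 1) :
    coverProb s {x ∈ X | √(c / (1 + c) * (1 + ε)) ≤ inner ℝ v x} ≤
      ENNReal.ofReal (Real.exp (-((c * ε / (4 * (1 + c))) ^ 2 * s ^ 2 / 2)) +
        Real.exp ((1 + c) * (s + 2) - c * ε * s ^ 2 / 4)) := by
  set P := stdGaussian (EuclideanSpace ℝ (Fin d))
  set A := {x ∈ X | √(c / (1 + c) * (1 + ε)) ≤ inner ℝ v x}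
  have hAX : A ⊆ X := Set.sep_subset _ _
  have hfin : A.Finite := hXc.1.subset hAX
  set τ := c * ε / (4 * (1 + c)) with hτ
  have hsub : {r | ∃ x ∈ A, s ≤ inner ℝ r x} ⊆ {r | τ * s ≤ inner ℝ v r} ∪
      ⋃ x ∈ hfin.toFinset, {r | s ≤ inner ℝ r x ∧ inner ℝ v r ≤ τ * s} := by
    rintro r ⟨x, hxA, hxs⟩
    rcases le_total (τ * s) (inner ℝ v r) with h | h
    · exact Or.inl h
    · refine Or.inr ?_
      simp only [Set.mem_iUnion]
      exact ⟨x, hfin.mem_toFinset.2 hxA, hxs, h⟩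
  have h1 : P.real {r | τ * s ≤ inner ℝ v r} ≤ Real.exp (-(τ ^ 2 * s ^ 2 / 2)) := by
    have h := stdGaussian_inner_ge_le ((τ * s) • v) ((τ * s) * (τ * s))
    have hτ0 : 0 ≤ τ * s := by positivity
    refine le_trans (measureReal_mono ?_) (h.trans_eq ?_)
    · intro r hr
      simp only [Set.mem_ofPred_eq, real_inner_smul_left] at hr ⊢
      gcongr
    · rw [norm_smul, hv, mul_one, Real.norm_eq_abs, sq_abs]
      ring_nf
  have h2 : P.real (⋃ x ∈ hfin.toFinset, {r | s ≤ inner ℝ r x ∧ inner ℝ v r ≤ τ * s}) ≤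
      Real.exp ((1 + c) * (s + 2) - c * ε * s ^ 2 / 4) := by
    have hcard : (hfin.toFinset.card : ℝ) ≤ Real.exp ((1 + c) * (s ^ 2 / 2 + s + 2)) := by
      rw [← Set.ncard_eq_toFinset_card A hfin]
      exact (Nat.cast_le.2 (Set.ncard_le_ncard hAX hXc.1)).trans
        (hXc.2.trans (gaussianTail_rpow_le hc hs))
    calc P.real (⋃ x ∈ hfin.toFinset, {r | s ≤ inner ℝ r x ∧ inner ℝ v r ≤ τ * s})
        ≤ ∑ x ∈ hfin.toFinset, P.real {r | s ≤ inner ℝ r x ∧ inner ℝ v r ≤ τ * s} :=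
          measureReal_biUnion_finset_le _ _
      _ ≤ ∑ x ∈ hfin.toFinset, Real.exp (-(s ^ 2 / 2 * (1 + c + c * ε / 2))) := by
          refine Finset.sum_le_sum fun x hx ↦ ?_
          obtain ⟨hxX, hxv⟩ := hfin.mem_toFinset.1 hx
          have hxv0 := (Real.sqrt_nonneg _).trans hxv
          refine stdGaussian_joint_tail_le hc (by positivity) x v (hX x hxX) hv hxv0 ?_ hs
          have h := (Real.sqrt_le_left hxv0).1 hxv
          have := mul_le_mul_of_nonneg_left h (show 0 ≤ 1 + c by positivity)
          refine le_trans (le_of_eq ?_) this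
          field_simp
      _ ≤ Real.exp ((1 + c) * (s ^ 2 / 2 + s + 2)) *
            Real.exp (-(s ^ 2 / 2 * (1 + c + c * ε / 2))) := by
          rw [Finset.sum_const, nsmul_eq_mul]
          gcongr
      _ = Real.exp ((1 + c) * (s + 2) - c * ε * s ^ 2 / 4) := by
          rw [← Real.exp_add]
          ring_nf
  rw [coverProb, ← ofReal_measureReal]
  exact ENNReal.ofReal_le_ofReal
    ((measureReal_mono hsub).trans ((measureReal_union_le _ _).trans (add_le_add h1 h2)))

/-- Once `log s ≥ 24 (1 + c) / c`, the two exponential terms of `coverProb_cap_le` are jointly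
below `exp (-c' ε² s²)`, where `c' = c² / (64 (1 + c)²)`. -/
lemma exp_add_exp_le {c s ε : ℝ} (hc : 0 < c) (hs : Real.exp (24 * (1 + c) / c) ≤ s)
    (hε : Real.log s / s ≤ ε) (hcε : c * ε ≤ 1) :
    Real.exp (-((c * ε / (4 * (1 + c))) ^ 2 * s ^ 2 / 2)) +
        Real.exp ((1 + c) * (s + 2) - c * ε * s ^ 2 / 4) ≤
      Real.exp (-(c ^ 2 / (64 * (1 + c) ^ 2)) * ε ^ 2 * s ^ 2) := by
  have hc1 : 0 < 1 + c := by linarith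
  have hs1 : 1 ≤ s := (Real.one_le_exp (by positivity)).trans hs
  have hs0 : 0 < s := by linarith
  have hlog : 24 * (1 + c) / c ≤ Real.log s := (Real.le_log_iff_exp_le hs0).2 hs
  have hεs : Real.log s ≤ ε * s := (div_le_iff₀ hs0).1 hε
  have hcεs : 24 * (1 + c) ≤ c * (ε * s) := by
    have := hlog.trans hεs
    rwa [div_le_iff₀ hc, mul_comm _ c] at this
  set w := c ^ 2 / (64 * (1 + c) ^ 2) * ε ^ 2 * s ^ 2 with hw
  have hw1 : 1 ≤ w := by
    have h : (8 * (1 + c)) ^ 2 ≤ (c * (ε * s)) ^ 2 := pow_le_pow_left₀ (by positivity)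
      (by linarith) 2
    rw [hw, show c ^ 2 / (64 * (1 + c) ^ 2) * ε ^ 2 * s ^ 2 =
      (c * (ε * s)) ^ 2 / (8 * (1 + c)) ^ 2 by field_simp; ring]
    rwa [one_le_div (by positivity)]
  have hε0 : 0 ≤ ε := by
    by_contra hneg
    nlinarith [mul_pos hc hs0, mul_pos (mul_pos hc hs0) (neg_pos.2 (not_le.1 hneg))]
  have e1 : -((c * ε / (4 * (1 + c))) ^ 2 * s ^ 2 / 2) = -(2 * w) := by
    rw [hw]; field_simp; ring
  have e2 : (1 + c) * (s + 2) - c * ε * s ^ 2 / 4 ≤ -(2 * w) := by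
    have h1 : 24 * (1 + c) * s ≤ c * ε * s ^ 2 := by
      nlinarith [mul_le_mul_of_nonneg_right hcεs hs0.le]
    have h2 : 2 * w ≤ c * ε * s ^ 2 / 8 := by
      have h3 : 2 * w = (c * ε) * (c * ε * s ^ 2) / (32 * (1 + c) ^ 2) := by
        rw [hw]; field_simp; ring
      rw [h3, div_le_div_iff₀ (by positivity) (by norm_num)]
      have h4 : c * ε * (c * ε * s ^ 2) ≤ 1 * (c * ε * s ^ 2) := by gcongr
      have h5 : c * ε * s ^ 2 * 1 ≤ c * ε * s ^ 2 * (1 + c) ^ 2 := by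
        gcongr; nlinarith
      nlinarith [show 0 ≤ c * ε * s ^ 2 by positivity]
    nlinarith [mul_le_mul_of_nonneg_left hs1 hc1.le]
  have e3 : Real.exp (-(2 * w)) = Real.exp (-w) * Real.exp (-w) := by
    rw [← Real.exp_add]; ring_nf
  have e4 : 2 * Real.exp (-w) ≤ 1 := by
    rw [Real.exp_neg, ← div_eq_mul_inv, div_le_one (Real.exp_pos _)]
    linarith [Real.add_one_le_exp w]
  rw [e1, show -(c ^ 2 / (64 * (1 + c) ^ 2)) * ε ^ 2 * s ^ 2 = -w by rw [hw]; ring]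
  have := Real.exp_le_exp.2 e2
  nlinarith [Real.exp_pos (-w)]

theorem isSpreadConstant_of_pos {c : ℝ} (hc : 0 < c) :
    IsSpreadConstant c (c ^ 2 / (64 * (1 + c) ^ 2)) := by
  refine ⟨by positivity, Real.exp (24 * (1 + c) / c), ?_⟩
  intro s hs d V X μ δ hV hP hXc ε hε v hv
  have hs1 : 1 ≤ s := (Real.one_le_exp (by positivity)).trans hs
  have hε0 : 0 ≤ ε := le_trans (div_nonneg (Real.log_nonneg hs1) (by linarith)) hε
  rcases le_or_gt (c * ε) 1 with hcε | hcε
  · refine (hP.2.1 _ (Set.sep_subset _ _)).trans ?_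
    refine (coverProb_cap_le hc (by linarith) hε0 hP.1 hXc v (hV v hv)).trans ?_
    exact ENNReal.ofReal_le_ofReal (exp_add_exp_le hc hs hε hcε)
  · -- The threshold exceeds `1`, so no unit vector reaches it.
    have hempty : {x ∈ X | √(c / (1 + c) * (1 + ε)) ≤ inner ℝ v x} = ∅ := by
      refine Set.eq_empty_of_forall_notMem fun x ⟨hxX, hx⟩ ↦ ?_
      have h1 := real_inner_le_norm v x
      rw [hV v hv, hP.1 x hxX, mul_one] at h1
      have h2 := (Real.sqrt_le_iff.1 (hx.trans h1)).2
      rw [div_mul_eq_mul_div, div_le_iff₀ (by linarith)] at h2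
      linarith
    rw [hempty, measure_empty]
    exact zero_le

/-! ### Truncated falling products -/

lemma convexOn_prod_max_sub (p : ℝ) (n : ℕ) :
    ConvexOn ℝ Set.univ (fun t : ℝ ↦ ∏ j ∈ Finset.range n, max (t - j * p) 0) ∧
      Monotone (fun t : ℝ ↦ ∏ j ∈ Finset.range n, max (t - j * p) 0) := by
  have hmono : ∀ a : ℝ, Monotone fun t : ℝ ↦ max (t - a) 0 := fun a s t hst ↦
    max_le_max (by linarith) le_rfl
  induction n with
  | zero => exact ⟨by simpa using convexOn_const (1 : ℝ) convex_univ, by simpa using monotone_const⟩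
  | succ n ih =>
    simp only [Finset.prod_range_succ]
    have h0 : ∀ t : ℝ, 0 ≤ ∏ j ∈ Finset.range n, max (t - j * p) 0 := fun t ↦
      Finset.prod_nonneg fun _ _ ↦ le_max_right _ _
    refine ⟨?_, ih.2.mul (hmono _) h0 fun _ ↦ le_max_right _ _⟩
    refine ih.1.mul (g := fun t : ℝ ↦ max (t - n * p) 0) ?_ (fun t _ ↦ h0 t)
      (fun _ _ ↦ le_max_right _ _) ((ih.2.monovary (hmono _)).monovaryOn _)
    exact ((convexOn_id convex_univ).sub (concaveOn_const _ convex_univ)).sup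
      (convexOn_const _ convex_univ)

/-- Jensen's inequality for weights of total mass at most `1`. -/
lemma ConvexOn.map_sum_le_of_sum_le_one {ι : Type*} {f : ℝ → ℝ} (hf : ConvexOn ℝ Set.univ f)
    (hf0 : f 0 ≤ 0) (T : Finset ι) (w a : ι → ℝ) (hw : ∀ i ∈ T, 0 ≤ w i)
    (hw1 : ∑ i ∈ T, w i ≤ 1) :
    f (∑ i ∈ T, w i * a i) ≤ ∑ i ∈ T, w i * f (a i) := by
  have h := hf.map_add_sum_le (t := T) (w := w) (p := a) (v := 1 - ∑ i ∈ T, w i) (q := 0) hw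
    (by ring) (fun _ _ ↦ Set.mem_univ _) (by linarith) (Set.mem_univ _)
  simp only [smul_eq_mul, mul_zero, zero_add] at h
  nlinarith [mul_nonneg (sub_nonneg.2 hw1) (neg_nonneg.2 hf0)]

/-- A lower bound for `(2n)! / n!`, by comparing `∑ log m` with `∫ log`. -/
lemma four_mul_div_exp_pow_le_prod {n : ℕ} (hn : 0 < n) :
    (4 * n / Real.exp 1) ^ n ≤ ∏ j ∈ Finset.range n, (2 * (n : ℝ) - j) := by
  have hn0 : (0 : ℝ) < n := by exact_mod_cast hn
  -- `x log x - x` is an antiderivative of `log x`.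
  have step : ∀ k ≤ n, Real.exp ((2 * n * Real.log (2 * n) - 2 * n) -
      ((2 * n - k) * Real.log (2 * n - k) - (2 * n - k))) ≤
      ∏ j ∈ Finset.range k, (2 * (n : ℝ) - j) := by
    intro k
    induction k with
    | zero => intro _; simp
    | succ k ih =>
      intro hk
      have hkn : (k : ℝ) + 1 ≤ n := by exact_mod_cast hk
      rw [Finset.prod_range_succ]
      push_cast
      set x : ℝ := 2 * n - k with hx
      have hx1 : 0 < x - 1 := by rw [hx]; linarith
      have hx0 : 0 < x := by linarith
      have hlog : (x - 1) * (Real.log x - Real.log (x - 1)) ≤ 1 := by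
        rw [← Real.log_div hx0.ne' hx1.ne']
        have h := Real.log_le_sub_one_of_pos (div_pos hx0 hx1)
        calc (x - 1) * Real.log (x / (x - 1)) ≤ (x - 1) * (x / (x - 1) - 1) := by gcongr
          _ = 1 := by field_simp; ring
      rw [show 2 * (n : ℝ) - (k + 1) = x - 1 by rw [hx]; ring]
      calc _ ≤ Real.exp ((2 * n * Real.log (2 * n) - 2 * n) - (x * Real.log x - x)) *
            Real.exp (Real.log x) := by
            rw [← Real.exp_add, Real.exp_le_exp]
            nlinarith
        _ ≤ _ := by
            rw [Real.exp_log hx0]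
            exact mul_le_mul_of_nonneg_right (ih (by omega)) hx0.le
  refine le_trans (le_of_eq ?_) (step n le_rfl)
  rw [← Real.exp_log (show 0 < 4 * n / Real.exp 1 by positivity), ← Real.exp_nat_mul,
    Real.log_div (by positivity) (Real.exp_pos _).ne', Real.log_exp,
    show (4 : ℝ) * n = 2 * (2 * n) by ring, Real.log_mul two_ne_zero (by positivity),
    Real.log_mul two_ne_zero hn0.ne', show 2 * (n : ℝ) - n = n by ring]
  ring_nf

/-! ### Greedy choice of a nearly orthogonal tuple -/

section Greedy

variable {α ι : Type*} [MeasurableSpace α]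

lemma integral_sum_indicator (ν : Measure α) [IsFiniteMeasure ν] (T : Finset ι) (w : ι → ℝ)
    (N : ι → Set α) (hN : ∀ i, MeasurableSet (N i)) (G : Set α) :
    IntegrableOn (fun x ↦ ∑ i ∈ T, (N i).indicator (fun _ ↦ w i) x) G ν ∧
      ∫ x in G, ∑ i ∈ T, (N i).indicator (fun _ ↦ w i) x ∂ν =
        ∑ i ∈ T, w i * ν.real (N i ∩ G) := by
  have hint : ∀ i ∈ T, Integrable ((N i).indicator fun _ ↦ w i) (ν.restrict G) := fun i _ ↦
    (integrable_const _).indicator (hN i)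
  refine ⟨integrable_finsetSum _ hint, ?_⟩
  rw [integral_finsetSum _ hint]
  refine Finset.sum_congr rfl fun i _ ↦ ?_
  rw [integral_indicator_const _ (hN i), measureReal_restrict_apply (hN i), smul_eq_mul, mul_comm]

/-- The first moment method. The set `X` need not be measurable: the averaging set has positive
measure for `μ.restrict X`, and hence meets `X`. -/
lemma exists_mem_sum_indicator_ge (μ : Measure α) (X : Set α) [IsFiniteMeasure (μ.restrict X)]
    (G : Set α) (hG : MeasurableSet G) (T : Finset ι) (w : ι → ℝ) (hw : ∀ i ∈ T, 0 ≤ w i)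
    (N : ι → Set α) (hN : ∀ i, MeasurableSet (N i)) {M : ℝ} (hM : (μ.restrict X).real G ≤ M)
    (hpos : 0 < ∑ i ∈ T, w i * (μ.restrict X).real (N i ∩ G)) :
    ∃ x ∈ X, x ∈ G ∧ ∑ i ∈ T, w i * (μ.restrict X).real (N i ∩ G) ≤
      M * ∑ i ∈ T, (N i).indicator (fun _ ↦ w i) x := by
  set ν := μ.restrict X
  obtain ⟨hint, heq⟩ := integral_sum_indicator ν T w N hN G
  set g : α → ℝ := fun x ↦ ∑ i ∈ T, (N i).indicator (fun _ ↦ w i) x with hg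
  have hgm : Measurable g := Finset.measurable_sum _ fun i _ ↦
    measurable_const.indicator (hN i)
  have hG0 : ν G ≠ 0 := by
    intro h0
    rw [Measure.restrict_eq_zero.2 h0, integral_zero_measure] at heq
    exact hpos.ne heq
  have hav := measure_setAverage_le_pos hG0 (measure_ne_top ν G) hint
  have hSm : MeasurableSet {x ∈ G | ⨍ a in G, g a ∂ν ≤ g x} :=
    hG.inter (measurableSet_le measurable_const hgm)
  rw [Measure.restrict_apply hSm] at hav
  obtain ⟨x, ⟨hxG, hx⟩, hxX⟩ := nonempty_of_measure_ne_zero hav.ne'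
  refine ⟨x, hxX, hxG, ?_⟩
  have hGpos : 0 < ν.real G := ENNReal.toReal_pos hG0 (measure_ne_top ν G)
  rw [setAverage_eq, heq, smul_eq_mul, inv_mul_le_iff₀ hGpos] at hx
  refine hx.trans (mul_le_mul_of_nonneg_right hM ?_)
  exact Finset.sum_nonneg fun i hi ↦ Set.indicator_nonneg (fun _ _ ↦ hw i hi) x

/-- Choosing points of `B` one at a time, each outside the neighbourhoods `C` of its predecessors
and each by the first moment method, loses a factor `M = ν B` per point against the potential
`∑ m i * ∏ (ν (N i ∩ B) - j p)₊`. The sets `C x` cost at most `p` each, which accounts for the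
falling factors. -/
lemma exists_greedy_sequence [Nonempty α] (μ : Measure α) (X : Set α)
    [IsFiniteMeasure (μ.restrict X)] (B : Set α) (hB : MeasurableSet B) (T : Finset ι) (m : ι → ℝ) (hm : ∀ i ∈ T, 0 ≤ m i)
    (N : ι → Set α) (hN : ∀ i, MeasurableSet (N i)) (C : α → Set α)
    (hC : ∀ x, MeasurableSet (C x)) {p : ℝ} (hp : ∀ x ∈ X, (μ.restrict X).real (C x) ≤ p) (n : ℕ)
    (hpos : 0 < ∑ i ∈ T, m i * ∏ j ∈ Finset.range n,
      max ((μ.restrict X).real (N i ∩ B) - j * p) 0) :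
    ∃ x : ℕ → α, (∀ k < n, x k ∈ X) ∧ (∀ k < n, ∀ j < k, x k ∉ C (x j)) ∧
      ∑ i ∈ T, m i * ∏ j ∈ Finset.range n, max ((μ.restrict X).real (N i ∩ B) - j * p) 0 ≤
        (μ.restrict X).real B ^ n * ∑ i ∈ T, {i | ∀ k < n, x k ∈ N i}.indicator m i := by
  classical
  set ν := μ.restrict X
  set W := ∑ i ∈ T, m i * ∏ j ∈ Finset.range n, max (ν.real (N i ∩ B) - j * p) 0
  suffices H : ∀ k ≤ n, ∃ x : ℕ → α, (∀ l < k, x l ∈ X) ∧ (∀ l < k, ∀ j < l, x l ∉ C (x j)) ∧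
      W ≤ ν.real B ^ k * ∑ i ∈ T, {i | ∀ l < k, x l ∈ N i}.indicator m i *
        ∏ j ∈ Finset.Ico k n, max (ν.real (N i ∩ B) - j * p) 0 by
    simpa using H n le_rfl
  intro k
  induction k with
  | zero =>
    intro _
    exact ⟨fun _ ↦ Classical.arbitrary α, by simp, by simp, by simp [W]⟩
  | succ k ih =>
    intro hk
    obtain ⟨x, hxX, hxC, hxW⟩ := ih (by omega)
    set w : ι → ℝ := fun i ↦ {i | ∀ l < k, x l ∈ N i}.indicator m i *
      ∏ j ∈ Finset.Ico (k + 1) n, max (ν.real (N i ∩ B) - j * p) 0 with hw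
    have hw0 : ∀ i ∈ T, 0 ≤ w i := fun i hi ↦ mul_nonneg
      (Set.indicator_apply_nonneg fun _ ↦ hm i hi)
      (Finset.prod_nonneg fun _ _ ↦ le_max_right _ _)
    set G := B \ ⋃ l ∈ Finset.range k, C (x l) with hGdef
    have hG : MeasurableSet G :=
      hB.diff (Finset.measurableSet_biUnion _ fun l _ ↦ hC (x l))
    have hNG : ∀ i, max (ν.real (N i ∩ B) - k * p) 0 ≤ ν.real (N i ∩ G) := by
      intro i
      refine max_le ?_ measureReal_nonneg
      have hsub : N i ∩ B ⊆ (N i ∩ G) ∪ ⋃ l ∈ Finset.range k, C (x l) := by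
        intro z hz
        by_cases h : z ∈ ⋃ l ∈ Finset.range k, C (x l)
        · exact Or.inr h
        · exact Or.inl ⟨hz.1, hz.2, h⟩
      have h1 := (measureReal_mono (μ := ν) hsub).trans (measureReal_union_le _ _)
      have h2 : ν.real (⋃ l ∈ Finset.range k, C (x l)) ≤ k * p := by
        refine (measureReal_biUnion_finset_le _ _).trans ?_
        refine (Finset.sum_le_card_nsmul _ _ p fun l hl ↦
          hp _ (hxX l (Finset.mem_range.1 hl))).trans_eq ?_
        simp
      linarith
    have hstep : ∑ i ∈ T, {i | ∀ l < k, x l ∈ N i}.indicator m i *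
        ∏ j ∈ Finset.Ico k n, max (ν.real (N i ∩ B) - j * p) 0 ≤
        ∑ i ∈ T, w i * ν.real (N i ∩ G) := by
      refine Finset.sum_le_sum fun i hi ↦ ?_
      rw [Finset.prod_eq_prod_Ico_succ_bot (by omega), mul_left_comm, mul_comm]
      exact mul_le_mul_of_nonneg_left (hNG i) (hw0 i hi)
    have hMk : 0 ≤ ν.real B ^ k := by positivity
    have hpos' : 0 < ∑ i ∈ T, w i * ν.real (N i ∩ G) := by
      refine lt_of_lt_of_le ?_ hstep
      by_contra hcon
      exact absurd (hpos.trans_le hxW) (not_lt.2 (mul_nonpos_of_nonneg_of_nonpos hMk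
        (not_lt.1 hcon)))
    obtain ⟨z, hzX, hzG, hz⟩ := exists_mem_sum_indicator_ge μ X G hG T w hw0 N hN
      (measureReal_mono Set.sdiff_subset) hpos'
    have hzC : ∀ l < k, z ∉ C (x l) := fun l hl hmem ↦
      hzG.2 (Set.mem_biUnion (Finset.mem_coe.2 (Finset.mem_range.2 hl)) hmem)
    refine ⟨Function.update x k z, fun l hl ↦ ?_, fun l hl j hj ↦ ?_, ?_⟩
    · rcases Nat.lt_succ_iff_lt_or_eq.1 hl with h | rfl
      · rw [Function.update_of_ne h.ne]; exact hxX l h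
      · rwa [Function.update_self]
    · rcases Nat.lt_succ_iff_lt_or_eq.1 hl with h | rfl
      · rw [Function.update_of_ne h.ne, Function.update_of_ne (hj.trans h).ne]
        exact hxC l h j hj
      · rw [Function.update_self, Function.update_of_ne hj.ne]
        exact hzC j hj
    · refine hxW.trans ((mul_le_mul_of_nonneg_left (hstep.trans hz) hMk).trans_eq ?_)
      rw [← mul_assoc, ← pow_succ]
      congr 1
      refine Finset.sum_congr rfl fun i _ ↦ ?_
      have hiff : (∀ l < k + 1, Function.update x k z l ∈ N i) ↔
          (∀ l < k, x l ∈ N i) ∧ z ∈ N i := by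
        rw [Nat.forall_lt_succ_right, Function.update_self]
        refine and_congr_left fun _ ↦ forall₂_congr fun l hl ↦ ?_
        rw [Function.update_of_ne hl.ne]
      by_cases h1 : ∀ l < k, x l ∈ N i <;> by_cases h2 : z ∈ N i <;>
        simp only [hw, Set.indicator_apply, Set.mem_ofPred_eq, hiff, h1, h2, and_true, and_false,
          if_true, if_false, zero_mul]

end Greedy

/-! ### Transferring the spread along a nearly orthogonal tuple -/

lemma norm_sum_sq_le_of_inner_le {E : Type*} [NormedAddCommGroup E] [InnerProductSpace ℝ E]
    {lam : ℝ} (hlam : 0 < lam) (x : ℕ → E) (n : ℕ) (hx : ∀ k < n, ‖x k‖ = 1)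
    (hxx : ∀ k < n, ∀ j < k, inner ℝ (x j) (x k) ≤ lam) :
    ‖∑ k ∈ Finset.range n, x k‖ ^ 2 ≤ n ^ 2 * lam + n := by
  induction n with
  | zero => simp
  | succ n ih =>
    have ih' := ih (fun k hk ↦ hx k (by omega)) fun k hk ↦ hxx k (by omega)
    rw [Finset.sum_range_succ, norm_add_sq_real, hx n (by omega), sum_inner]
    have h := Finset.sum_le_card_nsmul (Finset.range n) (fun j ↦ inner ℝ (x j) (x n)) lam
      fun j hj ↦ hxx n (by omega) j (Finset.mem_range.1 hj)
    rw [Finset.card_range, nsmul_eq_mul] at h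
    push_cast
    nlinarith

/-- The normalised sum of nearly orthogonal unit vectors is short, so a point that is
moderately correlated with all of them is strongly correlated with its direction. -/
lemma exists_unit_of_nearly_orthogonal {E : Type*} [NormedAddCommGroup E] [InnerProductSpace ℝ E]
    {lam κ : ℝ} (hlam : 0 < lam) (hκ : 0 < κ) (x : ℕ → E) {n : ℕ} (hn : 0 < n)
    (hx : ∀ k < n, ‖x k‖ = 1) (hxx : ∀ k < n, ∀ j < k, inner ℝ (x j) (x k) ≤ lam) :
    ∃ v : E, ‖v‖ = 1 ∧ ∀ y, (∀ k < n, √(lam * κ * (1 + 1 / (lam * n))) ≤ inner ℝ (x k) y) →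
      √κ ≤ inner ℝ v y := by
  have hn0 : (0 : ℝ) < n := by exact_mod_cast hn
  set z := ∑ k ∈ Finset.range n, x k
  have hz := norm_sum_sq_le_of_inner_le hlam x n hx hxx
  have hthr : n * √(lam * κ * (1 + 1 / (lam * n))) = √κ * √(n ^ 2 * lam + n) := by
    rw [← Real.sqrt_mul hκ.le, ← Real.sqrt_sq hn0.le, ← Real.sqrt_mul (sq_nonneg _),
      Real.sqrt_sq hn0.le]
    congr 1
    field_simp
  have hzy : ∀ y, (∀ k < n, √(lam * κ * (1 + 1 / (lam * n))) ≤ inner ℝ (x k) y) →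
      √κ * √(n ^ 2 * lam + n) ≤ inner ℝ z y := by
    intro y hy
    rw [← hthr, sum_inner]
    have h := Finset.card_nsmul_le_sum (Finset.range n) (fun k ↦ inner ℝ (x k) y) _
      fun k hk ↦ hy k (Finset.mem_range.1 hk)
    rwa [Finset.card_range, nsmul_eq_mul] at h
  rcases eq_or_ne z 0 with h0 | h0
  · refine ⟨x 0, hx 0 hn, fun y hy ↦ absurd (hzy y hy) ?_⟩
    rw [h0, inner_zero_left, not_le]
    positivity
  · have hz0 : 0 < ‖z‖ := norm_pos_iff.2 h0
    refine ⟨‖z‖⁻¹ • z, by rw [norm_smul, norm_inv, norm_norm, inv_mul_cancel₀ hz0.ne'],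
      fun y hy ↦ ?_⟩
    rw [real_inner_smul_left, inv_mul_eq_div, le_div_iff₀ hz0]
    refine le_trans ?_ (hzy y hy)
    gcongr
    exact Real.le_sqrt_of_sq_le hz

/-! ### The measure of the bad points -/

/-- If every sequence of `n` points of `X` avoiding each other's neighbourhoods `C` has common
weight at most `q < (4 α / e) ^ n`, then few points of `X` carry weight `2 α` or more: otherwise a
greedily chosen sequence of such points would have common weight at least
`∏ (2 α - j p / M) ≥ (4 α / e) ^ n`, where `M > p n / α` is their measure. -/
lemma measureReal_heavy_le {α ι : Type*} [MeasurableSpace α] [Nonempty α] (μ : Measure α)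
    (X : Set α) [IsFiniteMeasure (μ.restrict X)] (T : Finset ι) (m : ι → ℝ)
    (hm : ∀ i ∈ T, 0 ≤ m i) (hm1 : ∑ i ∈ T, m i ≤ 1) (N : ι → Set α)
    (hN : ∀ i, MeasurableSet (N i)) (C : α → Set α) (hC : ∀ x, MeasurableSet (C x)) {p a q : ℝ}
    (hp0 : 0 ≤ p) (hp : ∀ x ∈ X, (μ.restrict X).real (C x) ≤ p) {n : ℕ} (hn : 0 < n) (ha : 0 < a)
    (hq : ∀ x : ℕ → α, (∀ k < n, x k ∈ X) → (∀ k < n, ∀ j < k, x k ∉ C (x j)) →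
      ∑ i ∈ T, {i | ∀ k < n, x k ∈ N i}.indicator m i ≤ q)
    (hqa : q < (4 * a / Real.exp 1) ^ n) :
    (μ.restrict X).real {x | 2 * a ≤ ∑ i ∈ T, (N i).indicator (fun _ ↦ m i) x} ≤ p * n / a := by
  set ν := μ.restrict X
  set B := {x | 2 * a ≤ ∑ i ∈ T, (N i).indicator (fun _ ↦ m i) x}
  have hB : MeasurableSet B := measurableSet_le measurable_const
    (Finset.measurable_sum _ fun i _ ↦ measurable_const.indicator (hN i))
  by_contra! hcon
  have hn0 : (0 : ℝ) < n := by exact_mod_cast hn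
  set M := ν.real B
  have hM : 0 < M := lt_of_le_of_lt (by positivity) hcon
  have hpM : p ≤ a * M / n := by
    rw [div_lt_iff₀ ha] at hcon
    rw [le_div_iff₀ hn0]
    linarith
  obtain ⟨hint, heq⟩ := integral_sum_indicator ν T m N hN B
  have hF : 2 * a * M ≤ ∑ i ∈ T, m i * ν.real (N i ∩ B) := by
    rw [← heq]
    exact setIntegral_ge_of_const_le_real hB (measure_ne_top ν B) (fun x hx ↦ hx) hint
  obtain ⟨hconv, hmono⟩ := convexOn_prod_max_sub p n
  have hlow : (4 * a * M / Real.exp 1) ^ n ≤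
      ∏ j ∈ Finset.range n, max (2 * a * M - j * p) 0 := by
    calc (4 * a * M / Real.exp 1) ^ n
        = (a * M / n) ^ n * (4 * n / Real.exp 1) ^ n := by
          rw [← mul_pow]
          congr 1
          field_simp
      _ ≤ (a * M / n) ^ n * ∏ j ∈ Finset.range n, (2 * (n : ℝ) - j) :=
          mul_le_mul_of_nonneg_left (four_mul_div_exp_pow_le_prod hn) (by positivity)
      _ = ∏ j ∈ Finset.range n, (a * M / n * (2 * (n : ℝ) - j)) := by
          rw [Finset.prod_mul_distrib, Finset.prod_const, Finset.card_range]
      _ ≤ ∏ j ∈ Finset.range n, max (2 * a * M - j * p) 0 := by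
          refine Finset.prod_le_prod (fun j hj ↦ ?_) fun j _ ↦ le_max_of_le_left ?_
          · have : (j : ℝ) ≤ n := by exact_mod_cast (Finset.mem_range.1 hj).le
            exact mul_nonneg (by positivity) (by linarith)
          · have h1 : a * M / n * (2 * (n : ℝ) - j) = 2 * a * M - j * (a * M / n) := by
              field_simp
            rw [h1]
            gcongr
  have hW : (4 * a * M / Real.exp 1) ^ n ≤ ∑ i ∈ T, m i *
      ∏ j ∈ Finset.range n, max (ν.real (N i ∩ B) - j * p) 0 := by
    refine hlow.trans ((hmono hF).trans (hconv.map_sum_le_of_sum_le_one ?_ T m _ hm hm1))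
    -- The factor `j = 0` vanishes at `0`.
    exact (Finset.prod_eq_zero (Finset.mem_range.2 hn) (by simp)).le
  obtain ⟨x, hxX, hxC, hxW⟩ := exists_greedy_sequence μ X B hB T m hm N hN C hC hp n
    (lt_of_lt_of_le (by positivity) hW)
  have h1 := hW.trans (hxW.trans (mul_le_mul_of_nonneg_left (hq x hxX hxC) (by positivity)))
  rw [show 4 * a * M / Real.exp 1 = M * (4 * a / Real.exp 1) by ring, mul_pow] at h1
  exact (le_of_mul_le_mul_left h1 (by positivity)).not_gt hqa

/-! ### Refining a packing against another one -/

lemma IsPacking.measure_le_one_and_isFiniteMeasure {d : ℕ} {s δ : ℝ}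
    {X : Set (EuclideanSpace ℝ (Fin d))} {μ : Measure (EuclideanSpace ℝ (Fin d))} (h : IsPacking s δ X μ) :
    μ X ≤ 1 ∧ IsFiniteMeasure (μ.restrict X) := by
  have h1 : μ X ≤ 1 := (h.2.1 X subset_rfl).trans prob_le_one
  exact ⟨h1, ⟨by rw [Measure.restrict_apply_univ]; exact h1.trans_lt ENNReal.one_lt_top⟩⟩

lemma lt_four_mul_div_exp_pow {q a : ℝ} {n : ℕ} (hn : 0 < n) (hq : 0 < q)
    (ha : Real.exp 1 / 4 * q ^ (1 / (n : ℝ)) < a) : q < (4 * a / Real.exp 1) ^ n := by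
  have h1 : q ^ (1 / (n : ℝ)) < 4 * a / Real.exp 1 := by
    rw [lt_div_iff₀ (Real.exp_pos 1)]
    linarith
  have h2 := pow_lt_pow_left₀ h1 (by positivity) hn.ne'
  rwa [one_div, Real.rpow_inv_natCast_pow hq.le hn.ne'] at h2

theorem mainTheorem6 (c : ℝ) (hc : 0 < c) :
    ∃ c' : ℝ, IsSpreadConstant c c' ∧
      ∃ s₀ : ℝ, ∀ s₂ ≥ s₀, ∀ (d : ℕ) (X₁ X₂ : Set (EuclideanSpace ℝ (Fin d)))
        (μ₁ μ₂ : Measure (EuclideanSpace ℝ (Fin d))) (s₁ δ₁ δ₂ lam p : ℝ),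
        0 < lam → 0 < p →
        IsPacking s₁ δ₁ X₁ μ₁ → IsPacking s₂ δ₂ X₂ μ₂ →
        IsInefficient c s₂ X₂ → IsSpread lam p X₁ X₁ μ₁ →
        ∀ (σ : ℕ), 0 < σ → ∀ ε ≥ Real.log s₂ / s₂,
        ∀ α > Real.exp 1 / 4 * Real.exp (-c' * ε ^ 2 * s₂ ^ 2) ^ (1 / (σ : ℝ)),
          ∃ X₁' ⊆ X₁,
            μ₁ (X₁ \ X₁') ≤ ENNReal.ofReal (p * σ / α) ∧
            IsPacking s₁ (δ₁ - p * σ / α) X₁' μ₁ ∧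
            IsSpread (√(lam * (c / (1 + c)) * (1 + ε) * (1 + 1 / (lam * σ)))) (2 * α)
              X₁' X₂ μ₂ := by
  classical
  obtain ⟨hc', s₀, hs₀⟩ := isSpreadConstant_of_pos hc
  refine ⟨_, ⟨hc', s₀, hs₀⟩, max s₀ 1, ?_⟩
  intro s₂ hs₂ d X₁ X₂ μ₁ μ₂ s₁ δ₁ δ₂ lam p hlam hp hP₁ hP₂ hXc hsp σ hσ ε hε α hα
  have hs1 : 1 ≤ s₂ := (le_max_right _ _).trans hs₂
  have hε0 : 0 ≤ ε := le_trans (div_nonneg (Real.log_nonneg hs1) (by linarith)) hε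
  have hα0 : 0 < α := lt_trans (by positivity) hα
  obtain ⟨-, hfin₁⟩ := hP₁.measure_le_one_and_isFiniteMeasure
  obtain ⟨hμ₂, hfin₂⟩ := hP₂.measure_le_one_and_isFiniteMeasure
  -- `q` bounds the `μ₂`-measure of the points having inner product at least `t` with each of `σ`
  -- nearly orthogonal points of `X₁`.
  set q := Real.exp (-(c ^ 2 / (64 * (1 + c) ^ 2)) * ε ^ 2 * s₂ ^ 2)
  set κ := c / (1 + c) * (1 + ε) with hκ
  have hκ0 : 0 < κ := by positivity
  rw [show lam * (c / (1 + c)) * (1 + ε) = lam * κ by rw [hκ]; ring]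
  set t := √(lam * κ * (1 + 1 / (lam * σ)))
  set T := hXc.1.toFinset
  set m : EuclideanSpace ℝ (Fin d) → ℝ := fun y ↦ (μ₂.restrict X₂).real {y}
  set N : EuclideanSpace ℝ (Fin d) → Set (EuclideanSpace ℝ (Fin d)) := fun y ↦
    {x | t ≤ inner ℝ x y}
  have hN : ∀ y, MeasurableSet (N y) := fun y ↦
    measurableSet_le measurable_const (by fun_prop)
  set C : EuclideanSpace ℝ (Fin d) → Set (EuclideanSpace ℝ (Fin d)) := fun x ↦
    {z | lam ≤ inner ℝ x z}
  have hC : ∀ x, MeasurableSet (C x) := fun y ↦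
    measurableSet_le measurable_const (by fun_prop)
  have hmA : ∀ A : Set (EuclideanSpace ℝ (Fin d)),
      ∑ y ∈ T, A.indicator m y = (μ₂ {y ∈ X₂ | y ∈ A}).toReal := by
    intro A
    have hcoe : ((T.filter (· ∈ A) : Finset _) : Set (EuclideanSpace ℝ (Fin d))) =
        {y ∈ X₂ | y ∈ A} := by
      ext y; simp [T]
    simp only [Set.indicator_apply]
    rw [← Finset.sum_filter, sum_measureReal_singleton, hcoe, measureReal_def,
      Measure.restrict_eq_self _ (Set.sep_subset _ _)]
  have hm1 : ∑ y ∈ T, m y ≤ 1 := by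
    have h := hmA Set.univ
    simp only [Set.indicator_univ, Set.mem_univ, and_true, Set.ofPred_mem_eq] at h
    rw [h]
    exact ENNReal.toReal_le_of_le_ofReal zero_le_one (by simpa using hμ₂)
  have hpC : ∀ x ∈ X₁, (μ₁.restrict X₁).real (C x) ≤ p := by
    intro x hx
    rw [measureReal_def, Measure.restrict_apply (hC x), Set.inter_comm]
    exact ENNReal.toReal_le_of_le_ofReal hp.le (hsp x hx)
  have hq : ∀ x : ℕ → EuclideanSpace ℝ (Fin d), (∀ k < σ, x k ∈ X₁) →
      (∀ k < σ, ∀ j < k, x k ∉ C (x j)) →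
      ∑ y ∈ T, {y | ∀ k < σ, x k ∈ N y}.indicator m y ≤ q := by
    intro x hxX hxC
    obtain ⟨v, hv, hvy⟩ := exists_unit_of_nearly_orthogonal hlam hκ0 x hσ
      (fun k hk ↦ hP₁.1 _ (hxX k hk)) fun k hk j hj ↦ (not_le.1 (hxC k hk j hj)).le
    rw [hmA]
    refine ENNReal.toReal_le_of_le_ofReal (Real.exp_pos _).le (le_trans (measure_mono ?_)
      (hs₀ s₂ ((le_max_left _ _).trans hs₂) d {v} X₂ μ₂ δ₂ (by rintro _ rfl; exact hv) hP₂ hXc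
        ε hε v rfl))
    exact fun y hy ↦ ⟨hy.1, hvy y hy.2⟩
  have hbad := measureReal_heavy_le μ₁ X₁ T m (fun _ _ ↦ measureReal_nonneg) hm1 N hN C hC hp.le
    hpC hσ hα0 hq (lt_four_mul_div_exp_pow hσ (Real.exp_pos _) hα)
  set B := {x | 2 * α ≤ ∑ y ∈ T, (N y).indicator (fun _ ↦ m y) x}
  have hB : MeasurableSet B := measurableSet_le measurable_const
    (Finset.measurable_sum _ fun i _ ↦ measurable_const.indicator (hN i))
  have hdiff : X₁ \ (X₁ \ B) = B ∩ X₁ := by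
    rw [Set.sdiff_sdiff_right_self, Set.inter_comm]
  have hμB : μ₁ (X₁ \ (X₁ \ B)) ≤ ENNReal.ofReal (p * σ / α) := by
    rw [hdiff, ← Measure.restrict_apply hB, ← ofReal_measureReal]
    exact ENNReal.ofReal_le_ofReal hbad
  refine ⟨X₁ \ B, Set.sdiff_subset, hμB, ⟨fun x hx ↦ hP₁.1 x hx.1,
    fun X' hX' ↦ hP₁.2.1 X' (hX'.trans Set.sdiff_subset), ?_⟩, fun x hx ↦ ?_⟩
  · rw [ENNReal.ofReal_sub _ (by positivity), tsub_le_iff_right]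
    refine hP₁.2.2.trans ((measure_mono fun y hy ↦ ?_).trans ((measure_union_le _ _).trans
      (add_le_add_right hμB _)))
    exact (em (y ∈ X₁ \ B)).imp_right fun h ↦ ⟨hy, h⟩
  · have hxB : ∑ y ∈ T, {y | t ≤ inner ℝ x y}.indicator m y < 2 * α := not_le.1 hx.2
    rw [hmA] at hxB
    rw [← ENNReal.ofReal_toReal ((measure_mono (Set.sep_subset _ _)).trans_lt
      (hμ₂.trans_lt ENNReal.one_lt_top)).ne]
    exact ENNReal.ofReal_le_ofReal hxB.le
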